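/- Let $\lambda$ be a singular strong limit cardinal. Suppose that there is a uniform ultrafilter $U$ over $\lambda^+$ (that is, every set in $U$ has cardinality $\lambda^+$) which is $(\operatorname{cf}(\lambda),\lambda)$-indecomposable: for every cardinal $\theta$ with $\operatorname{cf}(\lambda)<\theta<\lambda$, every $B\in U$ and every function $f:B\to\theta$ there is a set $T\subseteq\theta$ with $|T|<\theta$ and $f^{-1}[T]\in U$. Then for every two graphs $\mathcal G_0=(G_0,E_0)$ and $\mathcal G_1=(G_1,E_1)$ with $|G_0|=|G_1|=\lambda^+$, if $\min\{\operatorname{Chr}(\mathcal G_0),\operatorname{Chr}(\mathcal G_1)\}\ge\lambda$, then $\operatorname{Chr}(\mathcal G_0\times\mathcal G_1)\ge\lambda$. Here a graph is a set of vertices with an irreflexive symmetric edge relation; $\operatorname{Chr}(\mathcal G)$ is the least cardinal $\mu$ for which there is a map $c$ from the vertices of $\mathcal G$ to $\mu$ with $c(x)\ne c(y)$ for all adjacent $x,y$; and $\mathcal G_0\times\mathcal G_1$ is the graph on $G_0\times G_1$ in which $(g_0,g_1)$ and $(g_0',g_1')$ are adjacent iff $(g_0,g_0')\in E_0$ and $(g_1,g_1')\in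 E_1$. -/

import Mathlib

open Cardinal

universe u

namespace IndecUltrafilter

/-- The positive sets of a filter `D`: those whose complement is not in `D`. -/
def Positive {α : Type u} (D : Filter α) (B : Set α) : Prop := Bᶜ ∉ D

/-- `D` is `θ`-indecomposable: for every positive `B` and every `f : B → θ` there is
`T ⊆ θ` with `|T| < θ` such that `f⁻¹[T]`, as a subset of the underlying set, is positive.
The cardinal `θ` is viewed as the well-ordered set of the ordinals below it. -/
def Indecomposable {α : Type u} (D : Filter α) (θ : Cardinal.{u}) : Prop :=
  ∀ B : Set α, Positive D B → ∀ f : B → θ.ord.ToType,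
    ∃ T : Set θ.ord.ToType, #T < θ ∧ Positive D (Subtype.val '' (f ⁻¹' T))

/-- `D` is `(χ, ν)`-indecomposable: `θ`-indecomposable for every infinite cardinal `θ`
with `χ < θ < ν`. -/
def IndecomposableIoo {α : Type u} (D : Filter α) (χ ν : Cardinal.{u}) : Prop :=
  ∀ θ : Cardinal.{u}, ℵ₀ ≤ θ → χ < θ → θ < ν → Indecomposable D θ

/-- An ultrafilter is uniform if each of its elements has the size of the whole underlying set. -/
def Uniform {α : Type u} (U : Ultrafilter α) : Prop := ∀ X ∈ U, #X = #α

/-- The chromatic number of a graph, as a (possibly infinite) cardinal: the least `κ` such that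
there is a proper colouring of the vertices with colours in `κ`. -/
noncomputable def chr {V : Type u} (G : SimpleGraph V) : Cardinal.{u} :=
  sInf {κ : Cardinal.{u} | Nonempty (G.Coloring κ.ord.ToType)}

/-- The product graph `G₀ × G₁`: two pairs are adjacent iff both of their coordinates are. -/
def productGraph {V₀ V₁ : Type u} (G₀ : SimpleGraph V₀) (G₁ : SimpleGraph V₁) :
    SimpleGraph (V₀ × V₁) where
  Adj p q := G₀.Adj p.1 q.1 ∧ G₁.Adj p.2 q.2
  symm := ⟨fun _ _ h => ⟨h.1.symm, h.2.symm⟩⟩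
  loopless := ⟨fun _ h => G₀.irrefl h.1⟩

end IndecUltrafilter

namespace IndecUltrafilter

open Filter Order

/-! Suppose `C` colours the product and `#C < lam`. If some `X` in `G₀` with `#X < lam` is not
`C`-colourable, then `X → C` colours `G₁`, with fewer than `lam` colours. Otherwise the colourings
of small pieces of `G₀` are glued twice: along a cofinal sequence in `lam`, at the cost of an
exponent `cf(lam)`, then along `U`, at the cost of an ultrapower. Indecomposability bounds that
ultrapower below `lam` (`mk_germ_le`), so `G₀` has too small a chromatic number. -/

theorem chr_le_of_coloring {V C : Type u} {G : SimpleGraph V} (c : G.Coloring C) :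
    chr G ≤ #C := by
  refine csInf_le' ?_
  have e : Nonempty (C ≃ (#C).ord.ToType) := Cardinal.eq.1 (mk_ord_toType _).symm
  exact ⟨G.recolorOfEquiv e.some c⟩

theorem nonempty_coloring_chr {V : Type u} (G : SimpleGraph V) :
    Nonempty (G.Coloring (chr G).ord.ToType) := by
  have h : {κ : Cardinal.{u} | Nonempty (G.Coloring κ.ord.ToType)}.Nonempty := by
    have e : Nonempty (V ≃ (#V).ord.ToType) := Cardinal.eq.1 (mk_ord_toType _).symm
    exact ⟨#V, ⟨G.recolorOfEquiv e.some G.selfColoring⟩⟩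
  exact csInf_mem h

theorem positive_coe_iff {α : Type u} {U : Ultrafilter α} {B : Set α} :
    Positive (U : Filter α) B ↔ B ∈ U := by
  rw [Positive, Ultrafilter.mem_coe, Ultrafilter.compl_mem_iff_notMem, not_not]

theorem power_lt_of_isStrongLimit {lam a b : Cardinal.{u}} (h : lam.IsStrongLimit)
    (ha : a < lam) (hb : b < lam) : a ^ b < lam := by
  calc a ^ b ≤ (2 ^ a) ^ b := power_le_power_right (cantor a).le
    _ = 2 ^ (a * b) := (power_mul).symm
    _ < lam := h.isStrongPrelimit (mul_lt_of_lt h.aleph0_le ha hb)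

theorem mk_Iio_ord_toType_lt {κ : Cardinal.{u}} (i : κ.ord.ToType) : #(Set.Iio i) < κ := by
  simpa using mk_Iio_lt i (by simp)

/-- A map into fewer than `ν` points takes at most `χ` values on some set of an ultrafilter that is
`(χ, ν)`-indecomposable. -/
theorem IndecomposableIoo.exists_preimage_mem {α C : Type u} {U : Ultrafilter α}
    {χ ν : Cardinal.{u}} (hU : IndecomposableIoo (U : Filter α) χ ν) (hχ : ℵ₀ ≤ χ)
    (hC : #C < ν) (f : α → C) : ∃ T : Set C, #T ≤ χ ∧ f ⁻¹' T ∈ U := by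
  -- Take `T` of least cardinality; if `#T > χ`, indecomposability at `θ = #T` yields a smaller one.
  obtain ⟨T, hT, hmin⟩ := WellFounded.has_min
    (InvImage.wf (fun T : Set C => #T) Cardinal.lt_wf) {T : Set C | f ⁻¹' T ∈ U}
    ⟨Set.univ, U.univ_mem⟩
  refine ⟨T, ?_, hT⟩
  by_contra! hlt
  have e : Nonempty (T ≃ (#T).ord.ToType) := Cardinal.eq.1 (mk_ord_toType _).symm
  obtain ⟨S, hS, hSpos⟩ := hU #T (hχ.trans hlt.le) hlt ((mk_set_le T).trans_lt hC) (f ⁻¹' T)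
    (positive_coe_iff.2 hT) (fun a => e.some ⟨f a, a.2⟩)
  refine hmin ((fun s => (e.some.symm s : C)) '' S) ?_ (mk_image_le.trans_lt hS)
  refine U.mem_of_superset (positive_coe_iff.1 hSpos) ?_
  rintro _ ⟨a, ha, rfl⟩
  exact ⟨_, ha, by simp⟩

/-- The ultrapower of a small set by a `(χ, lam)`-indecomposable ultrafilter has at most as many
elements as the power with exponent `χ`. -/
theorem IndecomposableIoo.mk_germ_le {α C : Type u} [Nonempty C] {U : Ultrafilter α}
    {χ lam : Cardinal.{u}} (hU : IndecomposableIoo (U : Filter α) χ lam)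
    (hlim : lam.IsStrongLimit) (hχ : ℵ₀ ≤ χ) (hχlam : χ < lam) (hC : #C < lam) :
    #(Germ (U : Filter α) C) ≤ #C ^ χ := by
  by_contra! hlt
  obtain ⟨S, hS⟩ := le_mk_iff_exists_set.1 (succ_le_of_lt hlt)
  have hSlt : #S < lam :=
    hS ▸ hlim.isSuccLimit.succ_lt (power_lt_of_isStrongLimit hlim hC hχlam)
  have hSC : #(S → C) < lam := by
    simpa using power_lt_of_isStrongLimit hlim hC hSlt
  choose r hr using fun s : S => Quotient.exists_rep s.1
  -- All representatives are bundled into one map to `S → C`. On a set in `U` it takes at most `χ`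
  -- values, so each germ in `S` is determined by a function `T → C`.
  obtain ⟨T, hT, hTU⟩ := hU.exists_preimage_mem hχ hSC (fun a s => r s a)
  have hinj : Function.Injective (fun (s : S) (t : T) => t.1 s) := by
    intro s s' hss
    have h : r s =ᶠ[U] r s' := mem_of_superset hTU fun a ha => congrFun hss ⟨_, ha⟩
    apply Subtype.ext
    rw [← hr s, ← hr s']
    exact Germ.coe_eq.2 h
  have h1 : #S ≤ #C ^ #T := by simpa using mk_le_of_injective hinj
  have h2 : succ (#C ^ χ) ≤ #C ^ χ :=
    hS ▸ h1.trans (power_le_power_left (mk_ne_zero C) hT)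
  exact (lt_succ _).not_ge h2

/-- A graph on a set of singular size is coloured by functions as soon as its smaller induced
subgraphs are coloured. -/
theorem coloring_of_forall_mk_lt {V C : Type u} [Nonempty C] {lam : Cardinal.{u}}
    {G : SimpleGraph V} (hlam : ℵ₀ ≤ lam) (hV : #V ≤ lam)
    (h : ∀ X : Set V, #X < lam → Nonempty ((G.induce X).Coloring C)) :
    ∃ S : Set lam.ord.ToType, #S = lam.ord.cof ∧ Nonempty (G.Coloring (S → C)) := by
  classical
  obtain ⟨S, hScof, hS⟩ := Order.exists_cof_eq lam.ord.ToType
  rw [Ordinal.cof_toType] at hS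
  refine ⟨S, hS, ?_⟩
  obtain ⟨f⟩ : Nonempty (V ↪ lam.ord.ToType) := by
    rw [← Cardinal.le_def]; simpa using hV
  have hX (s : lam.ord.ToType) : #{v | f v ≤ s} < lam := by
    have h1 : #(Set.Iic s) < lam := by
      rw [← Set.Iio_insert]
      exact mk_insert_le.trans_lt
        (add_lt_of_lt hlam (mk_Iio_ord_toType_lt s) (one_lt_aleph0.trans_le hlam))
    exact (mk_preimage_of_injective f (Set.Iic s) f.injective).trans_lt h1
  let c (s : S) := (h _ (hX s)).some
  -- The default value is harmless: an edge is separated at any `s ∈ S` above both endpoints.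
  refine ⟨SimpleGraph.Coloring.mk
    (fun v s => if hv : f v ≤ s then c s ⟨v, hv⟩ else Classical.arbitrary C) ?_⟩
  intro v w hvw heq
  obtain ⟨s, hs, hle⟩ := hScof (max (f v) (f w))
  have hv := (le_max_left _ _).trans hle
  have hw := (le_max_right _ _).trans hle
  have := congrFun heq ⟨s, hs⟩
  simp only [dif_pos hv, dif_pos hw] at this
  exact (c ⟨s, hs⟩).valid (v := ⟨v, hv⟩) (w := ⟨w, hw⟩) hvw this

/-- Given a uniform ultrafilter over `lam⁺`, a graph of size `lam⁺` is coloured by an ultrapower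
as soon as its induced subgraphs of size at most `lam` are coloured. -/
theorem coloring_germ_of_forall_mk_le {V C : Type u} [Nonempty C] {lam : Cardinal.{u}}
    {U : Ultrafilter (succ lam).ord.ToType} (hU : Uniform U) {G : SimpleGraph V}
    (hlam : ℵ₀ ≤ lam) (hV : #V = succ lam)
    (h : ∀ X : Set V, #X ≤ lam → Nonempty ((G.induce X).Coloring C)) :
    Nonempty (G.Coloring (Germ (U : Filter (succ lam).ord.ToType) C)) := by
  classical
  obtain ⟨f⟩ : Nonempty (V ↪ (succ lam).ord.ToType) := by
    rw [← Cardinal.le_def]; simpa using hV.le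
  have hIic (s : (succ lam).ord.ToType) : #(Set.Iic s) ≤ lam := by
    rw [← lt_succ_iff, ← Set.Iio_insert]
    have hs : ℵ₀ ≤ succ lam := hlam.trans (le_succ _)
    exact mk_insert_le.trans_lt
      (add_lt_of_lt hs (mk_Iio_ord_toType_lt s) (one_lt_aleph0.trans_le hs))
  have hX (s : (succ lam).ord.ToType) : #{v | f v ≤ s} ≤ lam :=
    (mk_preimage_of_injective f (Set.Iic s) f.injective).trans (hIic s)
  let c (s) := (h _ (hX s)).some
  refine ⟨SimpleGraph.Coloring.mk (fun v => Germ.ofFun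
    (fun s => if hv : f v ≤ s then c s ⟨v, hv⟩ else Classical.arbitrary C)) ?_⟩
  intro v w hvw heq
  have hmem := Germ.coe_eq.1 heq
  -- Initial segments have size at most `lam`, so uniformity puts every tail in `U`.
  have htail : Set.Ioi (max (f v) (f w)) ∈ U := by
    rw [← Set.compl_Iic, Ultrafilter.compl_mem_iff_notMem]
    intro hm
    have := hU _ hm
    rw [mk_ord_toType] at this
    exact (lt_succ lam).not_ge (this ▸ hIic _)
  obtain ⟨s, hs, hlt⟩ := U.nonempty_of_mem (inter_mem hmem htail)
  have hv := (le_max_left _ _).trans (Set.mem_Ioi.1 hlt).le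
  have hw := (le_max_right _ _).trans (Set.mem_Ioi.1 hlt).le
  simp only [Set.mem_ofPred_eq, dif_pos hv, dif_pos hw] at hs
  exact (c s).valid (v := ⟨v, hv⟩) (w := ⟨w, hw⟩) hvw hs

/-- If an induced subgraph of `G₀` on `X` cannot be coloured by `C`, then a colouring of the product
by `C` induces a colouring of `G₁` by functions from `X` to `C`. -/
theorem coloring_fun_of_productGraph {V₀ V₁ C : Type u} {G₀ : SimpleGraph V₀}
    {G₁ : SimpleGraph V₁} (c : (productGraph G₀ G₁).Coloring C) {X : Set V₀}
    (hX : IsEmpty ((G₀.induce X).Coloring C)) : Nonempty (G₁.Coloring (X → C)) := by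
  refine ⟨SimpleGraph.Coloring.mk (fun v x => c (x.1, v)) ?_⟩
  intro v w hvw heq
  -- If adjacent `v`, `w` received the same function, `x ↦ c (x, v)` would properly colour `X`.
  refine hX.false (SimpleGraph.Coloring.mk (fun x => c (x.1, v)) ?_)
  intro x y hxy hc
  have hadj : (productGraph G₀ G₁).Adj (x.1, v) (y.1, w) := ⟨hxy, hvw⟩
  exact c.valid hadj (hc.trans (congrFun heq y))

end IndecUltrafilter

theorem corollaryc215 (lam : Cardinal.{u})
    (hsing : lam.IsSingular) (hlim : lam.IsStrongLimit)
    (hU : ∃ U : Ultrafilter (Order.succ lam).ord.ToType,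
      IndecUltrafilter.Uniform U ∧
      IndecUltrafilter.IndecomposableIoo (U : Filter (Order.succ lam).ord.ToType)
        lam.ord.cof lam)
    (V₀ V₁ : Type u) (G₀ : SimpleGraph V₀) (G₁ : SimpleGraph V₁)
    (hV₀ : #V₀ = Order.succ lam) (hV₁ : #V₁ = Order.succ lam)
    (hchr : lam ≤ min (IndecUltrafilter.chr G₀) (IndecUltrafilter.chr G₁)) :
    lam ≤ IndecUltrafilter.chr (IndecUltrafilter.productGraph G₀ G₁) := by
  open IndecUltrafilter in
  obtain ⟨U, hunif, hind⟩ := hU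
  obtain ⟨h₀, h₁⟩ := le_min_iff.1 hchr
  by_contra! hlt
  obtain ⟨c⟩ := nonempty_coloring_chr (productGraph G₀ G₁)
  set C := (chr (productGraph G₀ G₁)).ord.ToType
  have hC : #C < lam := by simpa [C] using hlt
  have hsucc : Order.succ lam ≠ 0 := (Order.bot_lt_succ lam).ne'
  have : Nonempty V₀ := mk_ne_zero_iff.1 (hV₀ ▸ hsucc)
  have : Nonempty V₁ := mk_ne_zero_iff.1 (hV₁ ▸ hsucc)
  have : Nonempty C := Nonempty.map c inferInstance
  have hlam := hsing.aleph0_le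
  have hcof : ℵ₀ ≤ lam.ord.cof := by
    rw [Ordinal.aleph0_le_cof_iff, Ordinal.one_lt_cof_iff]
    exact isSuccLimit_ord hlam
  by_cases hsmall : ∀ X : Set V₀, #X < lam → Nonempty ((G₀.induce X).Coloring C)
  · obtain ⟨D, hD⟩ : ∃ D : Type u, #D = #C ^ lam.ord.cof := ⟨_, mk_out _⟩
    have hDlam : #D < lam := hD ▸ power_lt_of_isStrongLimit hlim hC hsing.cof_ord_lt
    have : Nonempty D := mk_ne_zero_iff.1 (hD ▸ power_ne_zero _ (mk_ne_zero C))
    have hmid (X : Set V₀) (hX : #X ≤ lam) : Nonempty ((G₀.induce X).Coloring D) := by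
      obtain ⟨S, hS, ⟨d⟩⟩ := coloring_of_forall_mk_lt (G := G₀.induce X) (C := C) hlam hX
        fun Y hY => by
          obtain ⟨d⟩ := hsmall (Subtype.val '' Y) (mk_image_le.trans_lt hY)
          exact ⟨SimpleGraph.Coloring.mk (fun y => d ⟨y.1.1, y.1, y.2, rfl⟩)
            fun {v w} hvw => d.valid (v := ⟨v.1.1, v.1, v.2, rfl⟩)
              (w := ⟨w.1.1, w.1, w.2, rfl⟩) hvw⟩
      obtain ⟨e⟩ : Nonempty ((S → C) ≃ D) := Cardinal.eq.1 (by simp [hS, hD])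
      exact ⟨SimpleGraph.recolorOfEquiv _ e d⟩
    obtain ⟨d⟩ := coloring_germ_of_forall_mk_le hunif hlam hV₀ hmid
    exact h₀.not_gt (((chr_le_of_coloring d).trans
      (hind.mk_germ_le hlim hcof hsing.cof_ord_lt hDlam)).trans_lt
      (power_lt_of_isStrongLimit hlim hDlam hsing.cof_ord_lt))
  · push Not at hsmall
    obtain ⟨X, hX, hempty⟩ := hsmall
    obtain ⟨d⟩ := coloring_fun_of_productGraph c (by simpa using hempty)
    refine h₁.not_gt ((chr_le_of_coloring d).trans_lt ?_)
    simpa using power_lt_of_isStrongLimit hlim hC hX
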